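/- Let $\mathbb T=\mathbb R/2\pi\mathbb Z$, let $|e|$ denote Lebesgue measure of $e\subset\mathbb T$, and let $\varphi_r\ge 0$ $(0<r<1)$ be integrable functions on $\mathbb T$ such that $$\int_{\mathbb T}\varphi_r(t)\,dt=1,\qquad 0<r<1,$$ and such that for all $\varepsilon>0$ and $0<\tau<1$ there is $\delta>0$ with $\int_e\varphi_r(t)\,dt<\varepsilon$ for all $0<r<\tau$ and all measurable $e\subset\mathbb T$ with $|e|<\delta$. Put $$\Phi_r(x,f)=\int_{\mathbb T}\varphi_r(x-t)f(t)\,dt,\qquad f\in L^\infty(\mathbb T).$$ Let $\lambda\in C[0,1]$ be real-valued with $\lambda(1)=0$ and suppose that $$\beta=\limsup_{\delta\to0+}\ \liminf_{r\to1-}\int_{-\delta\lambda(r)}^{\delta\lambda(r)}\varphi_r(t)\,dt=1 .$$ Then there is a function $B\in L^\infty(\mathbb T)$ which is the boundary function (the almost everywhere radial limit) of a Blaschke product on the unit disc, such that the limit $\lim_{r\to1-}\Phi_r(x+\lambda(r),B)$ does not exist for any $x\in\mathbb T$. -/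

import Mathlib

open Real Filter Topology MeasureTheory

noncomputable section

namespace LittlewoodKernels

instance fact_two_pi_pos : Fact (0 < 2 * π) := ⟨Real.two_pi_pos⟩

/-- The circle `ℝ / 2πℤ`; its `volume` is Lebesgue measure `dt`, of total mass `2π`. -/
abbrev Torus : Type := AddCircle (2 * π)

/-- The operators `Φ_r(x, f) = ∫_𝕋 φ_r(x - t) f(t) dt`. -/
def Phi (φ : ℝ → Torus → ℝ) (r : ℝ) (x : Torus) (f : Torus → ℂ) : ℂ :=
  ∫ t : Torus, (φ r (x - t) : ℂ) * f t

/-- The absolute continuity condition: for all `ε > 0` and `0 < τ < 1` there is `δ > 0` such that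
`∫_e φ_r < ε` for all `0 < r < τ` and all measurable `e ⊆ 𝕋` with `|e| < δ`. -/
def UniformlyAbsContinuous (φ : ℝ → Torus → ℝ) : Prop :=
  ∀ ε : ℝ, 0 < ε → ∀ τ : ℝ, 0 < τ → τ < 1 → ∃ δ : ℝ, 0 < δ ∧
    ∀ r : ℝ, 0 < r → r < τ → ∀ e : Set Torus, MeasurableSet e →
      volume e < ENNReal.ofReal δ → ∫ t in e, φ r t < ε

/-- `β = limsup_{δ → 0+} liminf_{r → 1-} ∫_{-δ λ(r)}^{δ λ(r)} φ_r(t) dt`.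
If `φ_r ≥ 0`, `∫_𝕋 φ_r = 1` and `λ(r) → 0` as `r → 1-`, then for each `δ` these integrals lie
in `[-1, 1]` for all `r` near `1`, so both limits are the genuine ones. -/
def beta (φ : ℝ → Torus → ℝ) (lam : ℝ → ℝ) : ℝ :=
  limsup (fun δ : ℝ =>
    liminf (fun r : ℝ => ∫ t in (-(δ * lam r))..(δ * lam r), φ r (t : Torus)) (𝓝[<] 1))
    (𝓝[>] 0)

/-- The Blaschke factor with zero `a`: `z` if `a = 0`, and
`(|a| / a) * (a - z) / (1 - conj a * z)` otherwise. -/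
def blaschkeFactor (a z : ℂ) : ℂ :=
  if a = 0 then z
  else ((‖a‖ : ℂ) / a) * ((a - z) / (1 - (starRingEnd ℂ) a * z))

/-- `F` is, on the open unit disc, the (finite or infinite) Blaschke product of a family of
points `a i` of the disc, listed with multiplicity, with `∑ (1 - |a i|) < ∞`.
(The summability forces the family to be countable.) -/
def IsBlaschkeProduct (F : ℂ → ℂ) : Prop :=
  ∃ (ι : Type) (a : ι → ℂ), (∀ i, ‖a i‖ < 1) ∧ Summable (fun i => 1 - ‖a i‖) ∧
    ∀ z : ℂ, ‖z‖ < 1 → HasProd (fun i => blaschkeFactor (a i) z) (F z)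

/-- `B` is the boundary function of `F`: for almost every `x`, `F (s e^{ix}) → B x` as
`s → 1-`. -/
def IsBoundaryFunction (F : ℂ → ℂ) (B : Torus → ℂ) : Prop :=
  ∀ᵐ x : Torus, Tendsto (fun s : ℝ => F ((s : ℂ) * (AddCircle.toCircle x : ℂ)))
    (𝓝[<] 1) (𝓝 (B x))

end LittlewoodKernels

end

noncomputable section

namespace LittlewoodKernels

/-- The Möbius transformation `w ↦ (R - w) / (1 - R w)` of the unit disc. -/
def mobius (R : ℝ) (w : ℂ) : ℂ := (R - w) / (1 - R * w)

section Mobius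

variable {R : ℝ} {w : ℂ}

lemma one_sub_le_norm_one_sub_mul (hR : 0 ≤ R) (hw : ‖w‖ ≤ 1) : 1 - R ≤ ‖1 - (R : ℂ) * w‖ := by
  have h := norm_sub_norm_le (1 : ℂ) ((R : ℂ) * w)
  rw [norm_mul, norm_one, Complex.norm_real, Real.norm_of_nonneg hR] at h
  nlinarith

lemma one_sub_mul_ne_zero (hR : 0 ≤ R) (hR1 : R < 1) (hw : ‖w‖ ≤ 1) : 1 - (R : ℂ) * w ≠ 0 := by
  have := one_sub_le_norm_one_sub_mul hR hw
  exact norm_pos_iff.1 (by linarith)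

lemma norm_sq_one_sub_mul_sub (R : ℝ) (w : ℂ) :
    ‖1 - (R : ℂ) * w‖ ^ 2 - ‖(R : ℂ) - w‖ ^ 2 = (1 - R ^ 2) * (1 - ‖w‖ ^ 2) := by
  simp only [← Complex.normSq_eq_norm_sq, Complex.normSq_apply]
  simp
  ring

lemma norm_mobius_le_one (hR : 0 ≤ R) (hR1 : R < 1) (hw : ‖w‖ ≤ 1) : ‖mobius R w‖ ≤ 1 := by
  have h0 := norm_pos_iff.2 (one_sub_mul_ne_zero hR hR1 hw)
  rw [mobius, norm_div, div_le_one h0]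
  refine le_of_sq_le_sq ?_ h0.le
  have h1 : 0 ≤ (1 - R ^ 2) * (1 - ‖w‖ ^ 2) :=
    mul_nonneg (by nlinarith) (by nlinarith [norm_nonneg w])
  linarith [norm_sq_one_sub_mul_sub R w]

lemma norm_mobius_eq_one (hR : 0 ≤ R) (hR1 : R < 1) (hw : ‖w‖ = 1) : ‖mobius R w‖ = 1 := by
  have h0 := norm_pos_iff.2 (one_sub_mul_ne_zero hR hR1 hw.le)
  rw [mobius, norm_div, div_eq_one_iff_eq h0.ne']
  have h := norm_sq_one_sub_mul_sub R w
  rw [hw] at h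
  exact (pow_left_inj₀ (norm_nonneg _) (norm_nonneg _) two_ne_zero).1 (by linarith)

lemma mobius_sub_one (hR : 0 ≤ R) (hR1 : R < 1) (hw : ‖w‖ ≤ 1) :
    mobius R w - 1 = -((1 - R) * (1 + w)) / (1 - R * w) := by
  have := one_sub_mul_ne_zero hR hR1 hw
  rw [mobius]
  field_simp
  ring

lemma mobius_add_one (hR : 0 ≤ R) (hR1 : R < 1) (hw : ‖w‖ ≤ 1) :
    mobius R w + 1 = (1 + R) * (1 - w) / (1 - R * w) := by
  have := one_sub_mul_ne_zero hR hR1 hw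
  rw [mobius]
  field_simp
  ring

lemma norm_one_sub_real {R : ℝ} (hR1 : R < 1) : ‖(1 : ℂ) - R‖ = 1 - R := by
  rw [← Complex.ofReal_one, ← Complex.ofReal_sub, Complex.norm_real,
    Real.norm_of_nonneg (by linarith)]

lemma norm_mobius_sub_one_le (hR : 0 ≤ R) (hR1 : R < 1) (hw : ‖w‖ ≤ 1) :
    ‖mobius R w - 1‖ ≤ 2 / (1 - R) * ‖w + 1‖ := by
  have h1 := one_sub_le_norm_one_sub_mul hR hw
  have h2 : 0 < 1 - R := by linarith
  rw [mobius_sub_one hR hR1 hw, norm_div, norm_neg, norm_mul, norm_one_sub_real hR1,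
    div_le_iff₀ (by linarith), add_comm w]
  calc (1 - R) * ‖1 + w‖ ≤ 2 * ‖1 + w‖ := by gcongr; linarith
    _ = 2 / (1 - R) * ‖1 + w‖ * (1 - R) := by field_simp
    _ ≤ _ := by gcongr

lemma norm_mobius_add_one_le (hR : 0 ≤ R) (hR1 : R < 1) (hw : ‖w‖ ≤ 1) :
    ‖mobius R w + 1‖ ≤ 2 / (1 - R) * ‖w - 1‖ := by
  have h1 := one_sub_le_norm_one_sub_mul hR hw
  have h2 : 0 < 1 - R := by linarith
  have h3 : ‖(1 : ℂ) + R‖ = 1 + R := by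
    rw [← Complex.ofReal_one, ← Complex.ofReal_add, Complex.norm_real,
      Real.norm_of_nonneg (by linarith)]
  rw [mobius_add_one hR hR1 hw, norm_div, norm_mul, h3, div_le_iff₀ (by linarith), norm_sub_rev w]
  calc (1 + R) * ‖1 - w‖ ≤ 2 * ‖1 - w‖ := by gcongr; linarith
    _ = 2 / (1 - R) * ‖1 - w‖ * (1 - R) := by field_simp
    _ ≤ _ := by gcongr

lemma norm_one_sub_le_two_mul {u : ℂ} (hu : ‖u‖ = 1) {t : ℝ} (ht : 0 ≤ t) (ht1 : t ≤ 1) :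
    ‖1 - u‖ ≤ 2 * ‖1 - (t : ℂ) * u‖ := by
  have h1 := one_sub_le_norm_one_sub_mul ht hu.le
  have h2 : ‖(t : ℂ) * u - u‖ = 1 - t := by
    rw [← sub_one_mul, norm_mul, hu, mul_one, norm_sub_rev]
    rw [← Complex.ofReal_one, ← Complex.ofReal_sub, Complex.norm_real,
      Real.norm_of_nonneg (by linarith)]
  calc ‖1 - u‖ = ‖(1 - (t : ℂ) * u) + ((t : ℂ) * u - u)‖ := by ring_nf
    _ ≤ ‖1 - (t : ℂ) * u‖ + ‖(t : ℂ) * u - u‖ := norm_add_le _ _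
    _ ≤ _ := by linarith

lemma norm_mobius_radial_sub_one_mul_le (hR : 0 ≤ R) (hR1 : R < 1) {u : ℂ} (hu : ‖u‖ = 1)
    {t : ℝ} (ht : 0 ≤ t) (ht1 : t ≤ 1) :
    ‖mobius R (t * u) - 1‖ * ‖1 - u‖ ≤ 4 * (1 - R) := by
  have hw : ‖(t : ℂ) * u‖ ≤ 1 := by
    rwa [norm_mul, hu, mul_one, Complex.norm_real, Real.norm_of_nonneg ht]
  have h0 := norm_pos_iff.2 (one_sub_mul_ne_zero hR hR1 hw)
  have h1 : ‖1 - u‖ ≤ 2 * ‖1 - (R : ℂ) * (t * u)‖ := by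
    have := norm_one_sub_le_two_mul hu (mul_nonneg hR ht) (by nlinarith : R * t ≤ 1)
    rwa [Complex.ofReal_mul, mul_assoc] at this
  have h2 : ‖1 + (t : ℂ) * u‖ ≤ 2 := (norm_add_le _ _).trans (by rw [norm_one]; linarith)
  rw [mobius_sub_one hR hR1 hw, norm_div, norm_neg, norm_mul, norm_one_sub_real hR1,
    div_mul_eq_mul_div, div_le_iff₀ h0]
  have h3 : 0 ≤ 1 - R := by linarith
  calc (1 - R) * ‖1 + (t : ℂ) * u‖ * ‖1 - u‖
      ≤ (1 - R) * 2 * (2 * ‖1 - (R : ℂ) * (t * u)‖) := by gcongr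
    _ = _ := by ring

end Mobius

section BlaschkeFactor

lemma norm_blaschkeFactor_sub_one_le {a z : ℂ} (ha : ‖a‖ < 1) (hz : ‖z‖ < 1) :
    ‖blaschkeFactor a z - 1‖ ≤ 2 / (1 - ‖z‖) * (1 - ‖a‖) := by
  have hz' : 0 < 1 - ‖z‖ := by linarith
  by_cases h : a = 0
  · rw [blaschkeFactor, if_pos h, h, norm_zero, sub_zero, mul_one, le_div_iff₀ hz']
    have : ‖z - 1‖ ≤ 2 := (norm_sub_le _ _).trans (by rw [norm_one]; linarith)
    nlinarith [norm_nonneg (z - 1), norm_nonneg z]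
  · have hden : 1 - ‖z‖ ≤ ‖1 - (starRingEnd ℂ) a * z‖ := by
      have := norm_sub_norm_le (1 : ℂ) ((starRingEnd ℂ) a * z)
      rw [norm_mul, norm_one, RCLike.norm_conj] at this
      nlinarith [norm_nonneg z]
    have hne : 1 - (starRingEnd ℂ) a * z ≠ 0 := norm_pos_iff.1 (by linarith)
    have hconj : (starRingEnd ℂ) a * a = (‖a‖ : ℂ) ^ 2 := RCLike.conj_mul a
    have key : blaschkeFactor a z - 1 =
        -((1 - (‖a‖ : ℂ)) * (1 + z * (‖a‖ / a))) / (1 - (starRingEnd ℂ) a * z) := by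
      rw [blaschkeFactor, if_neg h, eq_div_iff hne, sub_mul, mul_assoc, div_mul_cancel₀ _ hne]
      field_simp
      linear_combination z * hconj
    have h1 : ‖1 + z * ((‖a‖ : ℂ) / a)‖ ≤ 2 := by
      refine (norm_add_le _ _).trans ?_
      rw [norm_mul, norm_div, Complex.norm_real, norm_norm, div_self (norm_ne_zero_iff.2 h),
        norm_one]
      linarith
    rw [key, norm_div, norm_neg, norm_mul, norm_one_sub_real ha, div_le_iff₀ (by linarith)]
    have h3 : 0 ≤ 1 - ‖a‖ := by linarith
    calc (1 - ‖a‖) * ‖1 + z * ((‖a‖ : ℂ) / a)‖ ≤ (1 - ‖a‖) * 2 := by gcongr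
      _ = 2 / (1 - ‖z‖) * (1 - ‖a‖) * (1 - ‖z‖) := by field_simp
      _ ≤ _ := by gcongr

lemma multipliable_blaschkeFactor {ι : Type*} {a : ι → ℂ} (ha : ∀ i, ‖a i‖ < 1)
    (hs : Summable fun i => 1 - ‖a i‖) {z : ℂ} (hz : ‖z‖ < 1) :
    Multipliable fun i => blaschkeFactor (a i) z := by
  have : Summable fun i => ‖blaschkeFactor (a i) z - 1‖ :=
    Summable.of_nonneg_of_le (fun _ => norm_nonneg _)
      (fun i => norm_blaschkeFactor_sub_one_le (ha i) hz) (hs.mul_left _)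
  simpa using multipliable_one_add_of_summable this

lemma blaschkeFactor_mul_inv {ρ : ℝ} (hρ : 0 < ρ) {ω : ℂ} (hω : ‖ω‖ = 1) (z : ℂ) :
    blaschkeFactor (ρ * ω⁻¹) z = (ρ - ω * z) / (1 - ω * (ρ * z)) := by
  have h0 : ω ≠ 0 := norm_pos_iff.1 (by linarith)
  have hρ' : (ρ : ℂ) ≠ 0 := Complex.ofReal_ne_zero.2 hρ.ne'
  have hc : (starRingEnd ℂ) (ρ * ω⁻¹) = ρ * ω := by
    rw [map_mul, Complex.conj_ofReal, Complex.inv_eq_conj hω, Complex.conj_conj]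
  have hn : ‖(ρ : ℂ) * ω⁻¹‖ = ρ := by
    rw [norm_mul, norm_inv, hω, inv_one, mul_one, Complex.norm_real, Real.norm_of_nonneg hρ.le]
  rw [blaschkeFactor, if_neg (mul_ne_zero hρ' (inv_ne_zero h0)), hc, hn, ← mul_div_assoc]
  congr 1
  · field_simp
  · ring

lemma norm_eq_one_of_mem_nthRootsFinset {n : ℕ} (hn : 0 < n) {ω : ℂ}
    (h : ω ∈ Polynomial.nthRootsFinset n (1 : ℂ)) : ‖ω‖ = 1 :=
  Complex.norm_eq_one_of_pow_eq_one ((Polynomial.mem_nthRootsFinset hn 1).1 h) hn.ne'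

/-- The Blaschke product with zeros at `ρ` times the `n`-th roots of unity. -/
lemma prod_blaschkeFactor_nthRoots {n : ℕ} (hn : 0 < n) {ρ : ℝ} (hρ : 0 < ρ) (z : ℂ) :
    ∏ ω ∈ Polynomial.nthRootsFinset n (1 : ℂ), blaschkeFactor (ρ * ω⁻¹) z =
      mobius (ρ ^ n) (z ^ n) := by
  have hprim := Complex.isPrimitiveRoot_exp n hn.ne'
  rw [Finset.prod_congr rfl fun ω h =>
    blaschkeFactor_mul_inv hρ (norm_eq_one_of_mem_nthRootsFinset hn h) z, Finset.prod_div_distrib,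
    ← hprim.pow_sub_pow_eq_prod_sub_mul _ _ hn, ← hprim.pow_sub_pow_eq_prod_sub_mul _ _ hn, mobius,
    one_pow, mul_pow, Complex.ofReal_pow]

lemma mul_one_sub_rpow_inv_le {R : ℝ} (hR : 0 < R) {n : ℕ} (hn : 0 < n) :
    n * (1 - R ^ (n : ℝ)⁻¹) ≤ R⁻¹ - 1 := by
  have hn' : (0 : ℝ) < n := Nat.cast_pos.2 hn
  have h1 := Real.log_le_sub_one_of_pos (inv_pos.2 hR)
  have h2 := Real.add_one_le_exp ((n : ℝ)⁻¹ * Real.log R)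
  rw [mul_comm, ← Real.rpow_def_of_pos hR] at h2
  rw [Real.log_inv] at h1
  have h3 : (n : ℝ) * (Real.log R * (n : ℝ)⁻¹) = Real.log R := by field_simp
  nlinarith

end BlaschkeFactor

section Circle

/-- The point `e^{ix}` of the unit circle. -/
def circ (x : Torus) : ℂ := (AddCircle.toCircle x : ℂ)

lemma norm_circ (x : Torus) : ‖circ x‖ = 1 := Circle.norm_coe _

lemma continuous_circ : Continuous circ :=
  continuous_subtype_val.comp AddCircle.continuous_toCircle

lemma circ_add (x y : Torus) : circ (x + y) = circ x * circ y := by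
  simp [circ, AddCircle.toCircle_add]

lemma circ_nsmul (x : Torus) (n : ℕ) : circ (n • x) = circ x ^ n := by
  simp [circ, AddCircle.toCircle_nsmul]

lemma circ_coe (t : ℝ) : circ (t : Torus) = Complex.exp (Complex.I * t) := by
  rw [circ, AddCircle.toCircle_apply_mk, Circle.coe_exp, div_self (by positivity), one_mul, mul_comm]

lemma exists_coe_eq_abs_eq_norm (x : Torus) : ∃ t : ℝ, (t : Torus) = x ∧ |t| = ‖x‖ ∧ |t| ≤ π := by
  obtain ⟨t, rfl⟩ := QuotientAddGroup.mk_surjective x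
  have hp : (0 : ℝ) < 2 * π := by positivity
  obtain ⟨m, hm⟩ : ∃ m : ℤ, |t - m * (2 * π)| ≤ π := by
    refine ⟨round (t / (2 * π)), ?_⟩
    have := abs_sub_round (t / (2 * π))
    have h2 : t - round (t / (2 * π)) * (2 * π) = (t / (2 * π) - round (t / (2 * π))) * (2 * π) := by
      field_simp
    rw [h2, abs_mul, abs_of_pos hp]
    nlinarith [Real.pi_pos]
  have hc : ((t - m * (2 * π) : ℝ) : Torus) = (t : Torus) := by
    rw [AddCircle.coe_sub, sub_eq_self, AddCircle.coe_eq_zero_iff]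
    exact ⟨m, by simp⟩
  refine ⟨t - m * (2 * π), hc, ?_, hm⟩
  have h := (AddCircle.norm_coe_eq_abs_iff (2 * π) hp.ne').2
    (by rw [abs_of_pos hp]; linarith : |t - m * (2 * π)| ≤ |2 * π| / 2)
  rw [← h, hc]

lemma norm_circ_sub_one_le (x : Torus) : ‖circ x - 1‖ ≤ ‖x‖ := by
  obtain ⟨t, rfl, ht, -⟩ := exists_coe_eq_abs_eq_norm x
  rw [← ht, circ_coe]
  exact Real.norm_exp_I_mul_ofReal_sub_one_le

lemma norm_le_mul_norm_circ_sub_one (x : Torus) : ‖x‖ ≤ π / 2 * ‖circ x - 1‖ := by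
  obtain ⟨t, rfl, ht, hπ⟩ := exists_coe_eq_abs_eq_norm x
  rw [← ht, circ_coe, Complex.norm_exp_I_mul_ofReal_sub_one, norm_mul, Real.norm_eq_abs,
    Real.norm_eq_abs, abs_two]
  have := Real.mul_abs_le_abs_sin (x := t / 2) (by rw [abs_div, abs_two]; linarith)
  rw [abs_div, abs_two] at this
  calc |t| = π * (2 / π * (|t| / 2)) := by field_simp
    _ ≤ π * |sin (t / 2)| := by gcongr
    _ = _ := by ring

lemma volume_norm_circ_pow_sub_one_lt_le {n : ℕ} (hn : 2 ≤ n) (d : ℝ) :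
    volume {x : Torus | ‖circ x ^ n - 1‖ < d} ≤ ENNReal.ofReal (π * d) := by
  have hmp := (AddCircle.ergodic_nsmul (T := 2 * π) (n := n) hn).toMeasurePreserving
  calc volume {x : Torus | ‖circ x ^ n - 1‖ < d}
      ≤ volume ((fun x : Torus => n • x) ⁻¹' Metric.closedBall 0 (π / 2 * d)) := by
        refine measure_mono fun x hx => ?_
        rw [Set.mem_preimage, mem_closedBall_zero_iff]
        refine (norm_le_mul_norm_circ_sub_one _).trans ?_
        rw [circ_nsmul]
        gcongr
        exact le_of_lt hx
    _ = volume (Metric.closedBall (0 : Torus) (π / 2 * d)) :=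
        hmp.measure_preimage Metric.isClosed_closedBall.measurableSet.nullMeasurableSet
    _ ≤ _ := by
        rw [AddCircle.volume_closedBall]
        exact ENNReal.ofReal_le_ofReal ((min_le_right _ _).trans (by linarith))

end Circle

section Kernel

variable {k : Torus → ℝ}

lemma integrable_of_integral_eq_one (hk : ∫ t, k t = 1) : Integrable k := by
  by_contra h
  rw [integral_undef h] at hk
  exact zero_ne_one hk

lemma setIntegral_le_one (hk0 : ∀ t, 0 ≤ k t) (hk : ∫ t, k t = 1) (s : Set Torus) :
    ∫ t in s, k t ≤ 1 :=
  hk ▸ setIntegral_le_integral (integrable_of_integral_eq_one hk) (Eventually.of_forall hk0)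

/-- A kernel average of a function bounded by `2` and, off a set of small `k`-mass, by `a`. -/
lemma norm_integral_mul_le (hk0 : ∀ t, 0 ≤ k t) (hk : ∫ t, k t = 1) {D : Torus → ℂ}
    {E : Set Torus} (hE : MeasurableSet E) {a ε : ℝ} (y : Torus)
    (hD : ∀ᵐ t, ‖D t‖ ≤ 2) (hDE : ∀ᵐ t, t ∉ E → ‖D t‖ ≤ a) (ha : 0 ≤ a)
    (hkE : ∫ u in (fun u => y - u) ⁻¹' E, k u ≤ ε) :
    ‖∫ t, (k (y - t) : ℂ) * D t‖ ≤ a + 2 * ε := by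
  have hi := integrable_of_integral_eq_one hk
  have hmp : MeasurePreserving (fun u : Torus => y - u) volume volume :=
    volume.measurePreserving_sub_left y
  have h1 := integral_sub_left_eq_self (fun t => (k (y - t) : ℂ) * D t) volume y
  simp only [sub_sub_cancel] at h1
  rw [← h1]
  set F := (fun u : Torus => y - u) ⁻¹' E
  have hF : MeasurableSet F := hmp.measurable hE
  have hint : Integrable (fun u => a * k u + 2 * F.indicator k u) :=
    (hi.const_mul a).add ((hi.indicator hF).const_mul 2)
  calc ‖∫ u, (k u : ℂ) * D (y - u)‖ ≤ ∫ u, (a * k u + 2 * F.indicator k u) := by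
        refine norm_integral_le_of_norm_le hint ?_
        filter_upwards [hmp.quasiMeasurePreserving.ae hD, hmp.quasiMeasurePreserving.ae hDE]
          with u h2 h3
        rw [norm_mul, Complex.norm_real, Real.norm_of_nonneg (hk0 u)]
        by_cases hu : u ∈ F
        · rw [Set.indicator_of_mem hu]
          nlinarith [hk0 u]
        · rw [Set.indicator_of_notMem hu]
          nlinarith [hk0 u, h3 hu]
    _ = a + 2 * ∫ u in F, k u := by
        rw [integral_add (hi.const_mul a) ((hi.indicator hF).const_mul 2), integral_const_mul,
          integral_const_mul, hk, mul_one, integral_indicator hF]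
    _ ≤ _ := by linarith

lemma integrable_kernel_mul (hk : ∫ t, k t = 1) {G : Torus → ℂ}
    (hG : AEStronglyMeasurable G volume) (hG1 : ∀ᵐ t, ‖G t‖ ≤ 1) (y : Torus) :
    Integrable fun t => (k (y - t) : ℂ) * G t := by
  have hi : Integrable fun t => (k (y - t) : ℂ) :=
    ((integrable_of_integral_eq_one hk).comp_sub_left y).ofReal
  exact hi.mul_bdd hG hG1

lemma norm_integral_mul_sub_le (hk0 : ∀ t, 0 ≤ k t) (hk : ∫ t, k t = 1) {G H : Torus → ℂ}
    (hG : AEStronglyMeasurable G volume) (hG1 : ∀ᵐ t, ‖G t‖ ≤ 1)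
    (hH : AEStronglyMeasurable H volume) (hH1 : ∀ᵐ t, ‖H t‖ ≤ 1)
    {E : Set Torus} (hE : MeasurableSet E) {a ε : ℝ} (y : Torus)
    (hGH : ∀ᵐ t, t ∉ E → ‖G t - H t‖ ≤ a) (ha : 0 ≤ a)
    (hkE : ∫ u in (fun u => y - u) ⁻¹' E, k u ≤ ε) :
    ‖(∫ t, (k (y - t) : ℂ) * G t) - ∫ t, (k (y - t) : ℂ) * H t‖ ≤ a + 2 * ε := by
  rw [← integral_sub (integrable_kernel_mul hk hG hG1 y) (integrable_kernel_mul hk hH hH1 y)]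
  simp only [← mul_sub]
  refine norm_integral_mul_le hk0 hk hE y ?_ hGH ha hkE
  filter_upwards [hG1, hH1] with t h1 h2
  exact (norm_sub_le _ _).trans (by linarith)

lemma norm_integral_mul_sub_const_le (hk0 : ∀ t, 0 ≤ k t) (hk : ∫ t, k t = 1) {G : Torus → ℂ}
    (hG : AEStronglyMeasurable G volume) (hG1 : ∀ t, ‖G t‖ ≤ 1) {c : ℂ} (hc : ‖c‖ ≤ 1)
    {h a ε : ℝ} (y : Torus) (hGc : ∀ u : Torus, ‖u‖ ≤ h → ‖G (y - u) - c‖ ≤ a) (ha : 0 ≤ a)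
    (hkh : 1 - ε ≤ ∫ u in Metric.closedBall (0 : Torus) h, k u) :
    ‖(∫ t, (k (y - t) : ℂ) * G t) - c‖ ≤ a + 2 * ε := by
  have hi := integrable_of_integral_eq_one hk
  have hcint : ∫ t, (k (y - t) : ℂ) * c = c := by
    rw [integral_mul_const, integral_sub_left_eq_self (fun t => (k t : ℂ)) volume y,
      integral_complex_ofReal, hk, Complex.ofReal_one, one_mul]
  rw [← hcint]
  have hB : MeasurableSet (Metric.closedBall (0 : Torus) h) :=
    Metric.isClosed_closedBall.measurableSet
  have hE : MeasurableSet ((fun t : Torus => y - t) ⁻¹' (Metric.closedBall (0 : Torus) h)ᶜ) :=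
    (volume.measurePreserving_sub_left y).measurable hB.compl
  refine norm_integral_mul_sub_le hk0 hk hG (.of_forall hG1) aestronglyMeasurable_const
    (.of_forall fun _ => hc) hE y (.of_forall fun t ht => ?_) ha ?_
  · simp only [Set.mem_preimage, Set.mem_compl_iff, not_not, mem_closedBall_zero_iff] at ht
    simpa using hGc _ ht
  · have h1 := integral_add_compl hB hi
    rw [hk] at h1
    simp only [Set.preimage_preimage, sub_sub_cancel, Set.preimage_id']
    linarith

lemma integrableOn_kernel_coe (hk : Integrable k) :
    IntegrableOn (fun t : ℝ => k (t : Torus)) (Set.Ioc (-π) (-π + 2 * π)) :=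
  (AddCircle.measurePreserving_mk (2 * π) (-π)).integrable_comp_of_integrable hk

lemma intervalIntegral_le_setIntegral_closedBall (hk0 : ∀ t, 0 ≤ k t) (hk : Integrable k) {h : ℝ}
    (hh : 0 ≤ h) (hhπ : h ≤ π) :
    ∫ t in (-h)..h, k (t : Torus) ≤ ∫ u in Metric.closedBall (0 : Torus) h, k u := by
  have hB : MeasurableSet (Metric.closedBall (0 : Torus) h) :=
    Metric.isClosed_closedBall.measurableSet
  have hsub : Set.Ioc (-h) h ⊆ Set.Ioc (-π) (-π + 2 * π) :=
    Set.Ioc_subset_Ioc (by linarith) (by linarith)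
  rw [intervalIntegral.integral_of_le (by linarith), ← integral_indicator hB,
    ← AddCircle.integral_preimage (2 * π) (-π)]
  have hind : IntegrableOn (fun t : ℝ => (Metric.closedBall (0 : Torus) h).indicator k (t : Torus))
      (Set.Ioc (-π) (-π + 2 * π)) := integrableOn_kernel_coe (hk.indicator hB)
  calc ∫ t in Set.Ioc (-h) h, k (t : Torus)
      = ∫ t in Set.Ioc (-h) h, (Metric.closedBall (0 : Torus) h).indicator k (t : Torus) := by
        refine setIntegral_congr_fun measurableSet_Ioc fun t ht => ?_
        have ht' : |t| ≤ h := abs_le.2 ⟨ht.1.le, ht.2⟩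
        have h1 : ‖(t : Torus)‖ = |t| :=
          (AddCircle.norm_coe_eq_abs_iff (2 * π) two_pi_pos.ne').2
            (by rw [abs_of_pos two_pi_pos]; linarith)
        refine (Set.indicator_of_mem ?_ k).symm
        rwa [mem_closedBall_zero_iff, h1]
    _ ≤ _ := setIntegral_mono_set hind
        (.of_forall fun t => Set.indicator_nonneg (fun u _ => hk0 u) _) hsub.eventuallyLE

lemma abs_intervalIntegral_le_one (hk0 : ∀ t, 0 ≤ k t) (hk : ∫ t, k t = 1) {h : ℝ}
    (hh : |h| ≤ π) : |∫ t in (-h)..h, k (t : Torus)| ≤ 1 := by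
  have hi := integrable_of_integral_eq_one hk
  have key : ∀ h : ℝ, 0 ≤ h → h ≤ π → |∫ t in (-h)..h, k (t : Torus)| ≤ 1 := by
    intro h h0 hπ
    rw [abs_of_nonneg (intervalIntegral.integral_nonneg (by linarith) fun t _ => hk0 _)]
    exact (intervalIntegral_le_setIntegral_closedBall hk0 hi h0 hπ).trans
      (setIntegral_le_one hk0 hk _)
  rcases le_total 0 h with h0 | h0
  · exact key h h0 ((le_abs_self h).trans hh)
  · have := key (-h) (by linarith) ((neg_le_abs h).trans hh)
    rwa [neg_neg, intervalIntegral.integral_symm, abs_neg] at this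

end Kernel

section Concentration

variable {φ : ℝ → Torus → ℝ} {lam : ℝ → ℝ}

lemma tendsto_lam (hlam_cont : ContinuousOn lam (Set.Icc 0 1)) (hlam_one : lam 1 = 0) :
    Tendsto lam (𝓝[<] 1) (𝓝 0) := by
  have h := hlam_cont 1 (Set.right_mem_Icc.2 zero_le_one)
  rw [ContinuousWithinAt, hlam_one] at h
  refine h.mono_left (nhdsWithin_le_of_mem ?_)
  filter_upwards [Ioo_mem_nhdsLT (zero_lt_one' ℝ)] with r hr using ⟨hr.1.le, hr.2.le⟩

lemma eventually_abs_mul_lam_le (hlam_cont : ContinuousOn lam (Set.Icc 0 1)) (hlam_one : lam 1 = 0)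
    (δ : ℝ) : ∀ᶠ r in 𝓝[<] (1 : ℝ), |δ * lam r| ≤ π := by
  have h := ((tendsto_lam hlam_cont hlam_one).const_mul δ).abs
  rw [mul_zero, abs_zero] at h
  exact h.eventually_le_const Real.pi_pos

/-- The hypotheses on the kernels `φ r` and on the curve `lam`. -/
structure IsConcentratedAlong (φ : ℝ → Torus → ℝ) (lam : ℝ → ℝ) : Prop where
  nonneg : ∀ r : ℝ, 0 < r → r < 1 → ∀ t : Torus, 0 ≤ φ r t
  integral_eq_one : ∀ r : ℝ, 0 < r → r < 1 → ∫ t : Torus, φ r t = 1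
  uniformlyAbsContinuous : UniformlyAbsContinuous φ
  lam_cont : ContinuousOn lam (Set.Icc 0 1)
  lam_one : lam 1 = 0
  beta_eq_one : beta φ lam = 1

lemma IsConcentratedAlong.eventually_abs_intervalIntegral_le_one (hφ : IsConcentratedAlong φ lam) (δ : ℝ) :
    ∀ᶠ r in 𝓝[<] (1 : ℝ), |∫ t in (-(δ * lam r))..(δ * lam r), φ r (t : Torus)| ≤ 1 := by
  filter_upwards [eventually_abs_mul_lam_le hφ.lam_cont hφ.lam_one δ,
    Ioo_mem_nhdsLT (zero_lt_one' ℝ)] with r h1 hr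
  exact abs_intervalIntegral_le_one (hφ.nonneg r hr.1 hr.2) (hφ.integral_eq_one r hr.1 hr.2) h1

lemma IsConcentratedAlong.eventually_lt_intervalIntegral (hφ : IsConcentratedAlong φ lam) {δ₀ ε : ℝ} (hδ₀ : 0 < δ₀) (hε : 0 < ε) :
    ∃ δ, 0 < δ ∧ δ < δ₀ ∧
      ∀ᶠ r in 𝓝[<] (1 : ℝ), 1 - ε < ∫ t in (-(δ * lam r))..(δ * lam r), φ r (t : Torus) := by
  have hb := hφ.eventually_abs_intervalIntegral_le_one
  set g : ℝ → ℝ := fun δ =>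
    liminf (fun r : ℝ => ∫ t in (-(δ * lam r))..(δ * lam r), φ r (t : Torus)) (𝓝[<] 1) with hg
  have hbelow : ∀ δ, IsBoundedUnder (· ≥ ·) (𝓝[<] (1 : ℝ))
      (fun r : ℝ => ∫ t in (-(δ * lam r))..(δ * lam r), φ r (t : Torus)) := fun δ =>
    isBoundedUnder_of_eventually_ge ((hb δ).mono fun r hr => (abs_le.1 hr).1)
  have hgge : ∀ δ, -1 ≤ g δ := fun δ =>
    le_liminf_of_le (IsBoundedUnder.isCoboundedUnder_ge
      (isBoundedUnder_of_eventually_le ((hb δ).mono fun r hr => (abs_le.1 hr).2)))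
      ((hb δ).mono fun r hr => (abs_le.1 hr).1)
  have hfreq : ∃ᶠ δ in 𝓝[>] (0 : ℝ), 1 - ε < g δ := by
    intro hev
    have : beta φ lam ≤ 1 - ε :=
      limsup_le_of_le (IsBoundedUnder.isCoboundedUnder_le
        (isBoundedUnder_of_eventually_ge (.of_forall hgge)))
        (hev.mono fun δ h => not_lt.1 h)
    linarith [hφ.beta_eq_one]
  obtain ⟨δ, h1, h2⟩ := (hfreq.and_eventually (Ioo_mem_nhdsGT hδ₀)).exists
  exact ⟨δ, h2.1, h2.2, eventually_lt_of_lt_liminf h1 (hbelow δ)⟩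

/-- The kernels concentrate at the scale `o(lam r)`. -/
lemma IsConcentratedAlong.eventually_concentrated (hφ : IsConcentratedAlong φ lam) {δ₀ ε : ℝ} (hδ₀ : 0 < δ₀) (hε : 0 < ε) (hε1 : ε ≤ 1) :
    ∀ᶠ r in 𝓝[<] (1 : ℝ), 0 < lam r ∧
      1 - ε ≤ ∫ u in Metric.closedBall (0 : Torus) (δ₀ * lam r), φ r u := by
  obtain ⟨δ, hδ, hδδ₀, hev⟩ := hφ.eventually_lt_intervalIntegral hδ₀ hε
  filter_upwards [hev, eventually_abs_mul_lam_le hφ.lam_cont hφ.lam_one δ,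
    Ioo_mem_nhdsLT (zero_lt_one' ℝ)] with r h1 h2 hr
  have hk0 := hφ.nonneg r hr.1 hr.2
  have hi := integrable_of_integral_eq_one (hφ.integral_eq_one r hr.1 hr.2)
  have hpos : 0 < lam r := by
    by_contra! hneg
    have h0 : δ * lam r ≤ 0 := mul_nonpos_of_nonneg_of_nonpos hδ.le hneg
    have : 0 ≤ ∫ t in (δ * lam r)..(-(δ * lam r)), φ r (t : Torus) :=
      intervalIntegral.integral_nonneg (by linarith) fun t _ => hk0 _
    rw [intervalIntegral.integral_symm] at this
    linarith
  refine ⟨hpos, ?_⟩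
  have h3 := intervalIntegral_le_setIntegral_closedBall hk0 hi (mul_pos hδ hpos).le
    ((le_abs_self _).trans h2)
  have h4 : ∫ u in Metric.closedBall (0 : Torus) (δ * lam r), φ r u ≤
      ∫ u in Metric.closedBall (0 : Torus) (δ₀ * lam r), φ r u :=
    setIntegral_mono_set hi.integrableOn (.of_forall hk0)
      (Metric.closedBall_subset_closedBall (by gcongr)).eventuallyLE
  linarith

end Concentration

/-- The boundary function of `z ↦ mobius R (z ^ n)`. -/
def boundaryFactor (R : ℝ) (n : ℕ) (x : Torus) : ℂ := mobius R (circ x ^ n)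

lemma norm_circ_pow (x : Torus) (n : ℕ) : ‖circ x ^ n‖ = 1 := by
  rw [norm_pow, norm_circ, one_pow]

lemma norm_boundaryFactor {R : ℝ} (hR : 0 ≤ R) (hR1 : R < 1) (n : ℕ) (x : Torus) :
    ‖boundaryFactor R n x‖ = 1 :=
  norm_mobius_eq_one hR hR1 (norm_circ_pow x n)

lemma continuous_boundaryFactor {R : ℝ} (hR : 0 ≤ R) (hR1 : R < 1) (n : ℕ) :
    Continuous (boundaryFactor R n) := by
  have h : Continuous fun x : Torus => circ x ^ n := continuous_circ.pow n
  exact (continuous_const.sub h).div (continuous_const.sub (continuous_const.mul h))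
    fun x => one_sub_mul_ne_zero hR hR1 (norm_circ_pow x n).le

lemma norm_boundaryFactor_sub_le {R : ℝ} (hR : 0 ≤ R) (hR1 : R < 1) (n : ℕ) {c : ℂ}
    (hc : c = 1 ∨ c = -1) {y : Torus} (hy : circ y ^ n = -c) (u : Torus) :
    ‖boundaryFactor R n (y - u) - c‖ ≤ 2 / (1 - R) * (n * ‖u‖) := by
  have h1 : ‖circ (-u) ^ n - 1‖ ≤ n * ‖u‖ := by
    rw [← circ_nsmul]
    refine (norm_circ_sub_one_le _).trans ?_
    have := norm_nsmul_le (n := n) (a := -u)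
    rwa [norm_neg] at this
  have h2 : circ (y - u) ^ n = -c * circ (-u) ^ n := by
    rw [sub_eq_add_neg, circ_add, mul_pow, hy]
  have h3 : 0 ≤ 2 / (1 - R) := div_nonneg zero_le_two (by linarith)
  rw [boundaryFactor]
  rcases hc with rfl | rfl
  · refine (norm_mobius_sub_one_le hR hR1 (norm_circ_pow _ n).le).trans ?_
    rw [h2, neg_one_mul, neg_add_eq_sub, norm_sub_rev]
    gcongr
  · rw [sub_neg_eq_add]
    refine (norm_mobius_add_one_le hR hR1 (norm_circ_pow _ n).le).trans ?_
    rw [h2, neg_neg, one_mul]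
    gcongr

lemma exists_mem_Ico_circ_pow_eq {n : ℕ} (hn : 0 < n) (x : Torus) {w : ℂ} (hw : ‖w‖ = 1) :
    ∃ d ∈ Set.Ico (2 * π / n) (4 * π / n), circ (x + (d : Torus)) ^ n = w := by
  obtain ⟨t, rfl⟩ := QuotientAddGroup.mk_surjective x
  have hn' : (0 : ℝ) < n := Nat.cast_pos.2 hn
  have hp : 0 < 2 * π / n := by positivity
  obtain ⟨m, hm, -⟩ := existsUnique_add_zsmul_mem_Ico hp ((w.arg - n * t) / n) (2 * π / n)
  refine ⟨_, ⟨hm.1, hm.2.trans_eq (by ring)⟩, ?_⟩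
  have hw' : w = Complex.exp (w.arg * Complex.I) := by
    have := Complex.norm_mul_exp_arg_mul_I w
    rw [hw, Complex.ofReal_one, one_mul] at this
    exact this.symm
  have hn0 : (n : ℂ) ≠ 0 := Nat.cast_ne_zero.2 hn.ne'
  rw [show (QuotientAddGroup.mk t : Torus) = (t : Torus) from rfl, ← AddCircle.coe_add, circ_coe,
    ← Complex.exp_nat_mul]
  conv_rhs => rw [hw']
  rw [Complex.exp_eq_exp_iff_exists_int]
  refine ⟨m, ?_⟩
  rw [zsmul_eq_mul]
  push_cast
  field_simp
  ring

variable {φ : ℝ → Torus → ℝ} {lam : ℝ → ℝ}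

lemma IsConcentratedAlong.norm_Phi_sub_le (hφ : IsConcentratedAlong φ lam) {P : Torus → ℂ}
    (hP : Continuous P) (hP1 : ∀ x, ‖P x‖ = 1) {R : ℝ} (hR : 0 ≤ R) (hR1 : R < 1) {n : ℕ}
    (hn : 0 < n) {η δ₀ : ℝ} (hδ₀ : 0 < δ₀) (hδ₀R : δ₀ * 300 ≤ 1 - R)
    (hη : ∀ x y, dist x y < η → ‖P x - P y‖ ≤ 1 / 10) (hnη : 8 * π / n < η)
    {r : ℝ} (hr0 : 0 < r) (hr1 : r < 1) (hlam : 0 < lam r) (hlam' : lam r < 4 * π / n)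
    (hconc : 1 - 1 / 20 ≤ ∫ u in Metric.closedBall (0 : Torus) (δ₀ * lam r), φ r u)
    {x : Torus} {c : ℂ} (hc : c = 1 ∨ c = -1) (hx : circ (x + (lam r : Torus)) ^ n = -c) :
    ‖Phi φ r (x + (lam r : Torus)) (fun t => P t * boundaryFactor R n t) - P x * c‖ ≤ 3 / 10 := by
  have hn' : (0 : ℝ) < n := Nat.cast_pos.2 hn
  have hb1 := norm_boundaryFactor hR hR1 n
  have hc1 : ‖c‖ = 1 := by rcases hc with rfl | rfl <;> simp
  have hnlam : n * lam r ≤ 4 * π := by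
    rw [lt_div_iff₀ hn'] at hlam'
    linarith
  have main := norm_integral_mul_sub_const_le (hφ.nonneg r hr0 hr1) (hφ.integral_eq_one r hr0 hr1)
    (G := fun t => P t * boundaryFactor R n t) (c := P x * c)
    (hP.mul (continuous_boundaryFactor hR hR1 n)).aestronglyMeasurable
    (fun t => by rw [norm_mul, hP1, hb1, one_mul]) (by rw [norm_mul, hP1, hc1, one_mul])
    (x + (lam r : Torus)) (a := 1 / 5) (h := δ₀ * lam r) (ε := 1 / 20) ?_ (by norm_num) hconc
  · exact main.trans (by norm_num)
  intro u hu
  set y := x + (lam r : Torus) with hy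
  have hδ₀1 : δ₀ ≤ 1 := by linarith
  have hlamn : ‖(lam r : Torus)‖ ≤ lam r := by
    exact (QuotientAddGroup.norm_mk_le_norm).trans_eq (Real.norm_of_nonneg hlam.le)
  have hPu : ‖P (y - u) - P x‖ ≤ 1 / 10 := by
    refine hη _ _ ?_
    rw [dist_eq_norm, hy, add_sub_assoc, add_sub_cancel_left]
    have h8 : 8 * π / n = 4 * π / n + 4 * π / n := by ring
    calc ‖(lam r : Torus) - u‖ ≤ lam r + δ₀ * lam r := (norm_sub_le _ _).trans (by linarith)
      _ ≤ lam r + lam r := by nlinarith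
      _ < η := by linarith
  have hbu : ‖boundaryFactor R n (y - u) - c‖ ≤ 1 / 10 := by
    refine (norm_boundaryFactor_sub_le hR hR1 n hc hx u).trans ?_
    rw [div_mul_eq_mul_div, div_le_iff₀ (by linarith)]
    have h1 : n * ‖u‖ ≤ δ₀ * (4 * π) := by
      calc (n : ℝ) * ‖u‖ ≤ n * (δ₀ * lam r) := by gcongr
        _ = δ₀ * (n * lam r) := by ring
        _ ≤ _ := by gcongr
    nlinarith [Real.pi_lt_d2]
  calc ‖P (y - u) * boundaryFactor R n (y - u) - P x * c‖
      = ‖P (y - u) * (boundaryFactor R n (y - u) - c) + (P (y - u) - P x) * c‖ := by ring_nf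
    _ ≤ ‖P (y - u)‖ * ‖boundaryFactor R n (y - u) - c‖ + ‖P (y - u) - P x‖ * ‖c‖ := by
        refine (norm_add_le _ _).trans ?_
        rw [norm_mul, norm_mul]
    _ ≤ _ := by
        rw [hP1, hc1]
        linarith

lemma exists_mem_Ioo_lam_eq (hcont : ContinuousOn lam (Set.Icc 0 1)) (hone : lam 1 = 0)
    {s d : ℝ} (hs0 : 0 ≤ s) (hs1 : s ≤ 1) (hd : 0 < d) (hds : d < lam s) :
    ∃ r ∈ Set.Ioo s 1, lam r = d := by
  have h := intermediate_value_Ioo' hs1 (hcont.mono (Set.Icc_subset_Icc_left hs0))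
  exact h ⟨hone ▸ hd, hds⟩

/-- The data of one more factor: its parameters, the new threshold and the new budget. -/
structure IsNextFactor (φ : ℝ → Torus → ℝ) (lam : ℝ → ℝ) (P : Torus → ℂ) (τ d R : ℝ) (n : ℕ)
    (τ' d' : ℝ) : Prop where
  R_eq : R = 1 - d' ^ 2 / 4
  two_le : 2 ≤ n
  lt_tau : τ < τ'
  tau_lt_one : τ' < 1
  one_sub_tau_le : 1 - τ' ≤ (1 - τ) / 2
  d_pos : 0 < d'
  d_le : d' ≤ d / 2
  d_le_const : d' ≤ 1 / 20
  setIntegral_lt : ∀ r, 0 < r → r < τ → ∀ e : Set Torus, MeasurableSet e →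
    volume e < ENNReal.ofReal (8 * d') → ∫ t in e, φ r t < 1 / 20
  oscillation : ∀ x : Torus, ∃ r₁ ∈ Set.Ioo τ τ', ∃ r₂ ∈ Set.Ioo τ τ', 7 / 5 ≤
    ‖Phi φ r₁ (x + (lam r₁ : Torus)) (fun t => P t * boundaryFactor R n t) -
      Phi φ r₂ (x + (lam r₂ : Torus)) (fun t => P t * boundaryFactor R n t)‖

lemma IsConcentratedAlong.exists_isNextFactor (hφ : IsConcentratedAlong φ lam) {P : Torus → ℂ}
    (hP : Continuous P) (hP1 : ∀ x, ‖P x‖ = 1) {τ d : ℝ} (hτ : 0 < τ) (hτ1 : τ < 1) (hd : 0 < d) :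
    ∃ R n τ' d', IsNextFactor φ lam P τ d R n τ' d' := by
  obtain ⟨δ, hδ, hδe⟩ := hφ.uniformlyAbsContinuous (1 / 20) (by norm_num) τ hτ hτ1
  obtain ⟨d', hd'0, hd'1, hd'2, hd'3⟩ : ∃ d', 0 < d' ∧ d' ≤ d / 2 ∧ d' ≤ 1 / 20 ∧ 8 * d' ≤ δ := by
    refine ⟨min (d / 2) (min (1 / 20) (δ / 8)), by positivity, min_le_left _ _,
      (min_le_right _ _).trans (min_le_left _ _), ?_⟩
    have := (min_le_right (d / 2) (min (1 / 20) (δ / 8))).trans (min_le_right _ _)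
    linarith
  obtain ⟨R, hRdef⟩ : ∃ R, R = 1 - d' ^ 2 / 4 := ⟨_, rfl⟩
  have hR1 : R < 1 := by rw [hRdef]; linarith [pow_pos hd'0 2]
  have hR0 : 0 ≤ R := by rw [hRdef]; nlinarith
  obtain ⟨η, hη0, hη⟩ := Metric.uniformContinuous_iff.1
    (CompactSpace.uniformContinuous_of_continuous hP) (1 / 10) (by norm_num)
  have hη' : ∀ x y, dist x y < η → ‖P x - P y‖ ≤ 1 / 10 := fun x y h => by
    rw [← dist_eq_norm]; exact (hη h).le
  have hδ₀ : 0 < (1 - R) / 300 := by linarith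
  obtain ⟨τ₁, hτ₁, hgood⟩ := (mem_nhdsLT_iff_exists_Ioo_subset' (zero_lt_one' ℝ)).1
    (hφ.eventually_concentrated (ε := 1 / 20) hδ₀ (by norm_num) (by norm_num))
  obtain ⟨s, hs, hs1⟩ : ∃ s, max ((1 + τ) / 2) τ₁ < s ∧ s < 1 :=
    exists_between (max_lt (by linarith) hτ₁)
  have hsτ := (le_max_left _ _).trans_lt hs
  have hsτ₁ := (le_max_right _ _).trans_lt hs
  have hs0 : 0 < s := by linarith
  have hlams : 0 < lam s := (hgood ⟨hsτ₁, hs1⟩).1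
  obtain ⟨n, hn2, hn4, hn8⟩ : ∃ n : ℕ, 2 ≤ n ∧ 4 * π / n < lam s ∧ 8 * π / n < η :=
    ((eventually_ge_atTop 2).and
      (((tendsto_const_div_atTop_nhds_zero_nat (4 * π)).eventually_lt_const hlams).and
        ((tendsto_const_div_atTop_nhds_zero_nat (8 * π)).eventually_lt_const hη0))).exists
  have hn0 : 0 < n := by omega
  have hn' : (0 : ℝ) < n := Nat.cast_pos.2 hn0
  have hp : 0 < 2 * π / n := by positivity
  obtain ⟨τ₂, hτ₂, hsmall⟩ := (mem_nhdsLT_iff_exists_Ioo_subset' (zero_lt_one' ℝ)).1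
    ((tendsto_lam hφ.lam_cont hφ.lam_one).eventually_lt_const hp)
  obtain ⟨τ', hτ', hτ'1⟩ : ∃ τ', max s τ₂ < τ' ∧ τ' < 1 := exists_between (max_lt hs1 hτ₂)
  have hsτ' := (le_max_left _ _).trans_lt hτ'
  have hτ₂τ' := (le_max_right _ _).trans_lt hτ'
  have key : ∀ (x : Torus) (c : ℂ), (c = 1 ∨ c = -1) → ∃ r ∈ Set.Ioo τ τ',
      ‖Phi φ r (x + (lam r : Torus)) (fun t => P t * boundaryFactor R n t) - P x * c‖
        ≤ 3 / 10 := by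
    intro x c hc
    have hc1 : ‖-c‖ = 1 := by rcases hc with rfl | rfl <;> simp
    obtain ⟨e, he, hxe⟩ := exists_mem_Ico_circ_pow_eq hn0 x hc1
    obtain ⟨r, hr, rfl⟩ := exists_mem_Ioo_lam_eq hφ.lam_cont hφ.lam_one hs0.le hs1.le
      (hp.trans_le he.1) (he.2.trans hn4)
    have hrτ' : r < τ' := by
      by_contra! h
      exact absurd (hsmall ⟨hτ₂τ'.trans_le h, hr.2⟩ : lam r < _) (not_lt.2 he.1)
    exact ⟨r, ⟨by linarith [hr.1], hrτ'⟩, hφ.norm_Phi_sub_le hP hP1 hR0 hR1 hn0 hδ₀ (by linarith)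
      hη' hn8 (hs0.trans hr.1) hr.2 (hp.trans_le he.1) he.2
      (hgood ⟨hsτ₁.trans hr.1, hr.2⟩).2 hc hxe⟩
  refine ⟨R, n, τ', d', hRdef, hn2, by linarith, hτ'1, by linarith, hd'0, hd'1, hd'2, ?_, ?_⟩
  · intro r hr0 hrτ e he hev
    exact hδe r hr0 hrτ e he (hev.trans_le (ENNReal.ofReal_le_ofReal hd'3))
  · intro x
    obtain ⟨r₁, hr₁, h₁⟩ := key x 1 (.inl rfl)
    obtain ⟨r₂, hr₂, h₂⟩ := key x (-1) (.inr rfl)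
    refine ⟨r₁, hr₁, r₂, hr₂, ?_⟩
    set A := Phi φ r₁ (x + (lam r₁ : Torus)) (fun t => P t * boundaryFactor R n t)
    set A' := Phi φ r₂ (x + (lam r₂ : Torus)) (fun t => P t * boundaryFactor R n t)
    have h2 : ‖(2 : ℂ) * P x‖ = 2 := by rw [norm_mul, hP1, mul_one, Complex.norm_ofNat]
    have h3 : (2 : ℂ) * P x = (A - A') - (A - P x * 1) + (A' - P x * -1) := by ring
    have h4 : ‖(2 : ℂ) * P x‖ ≤ ‖A - A'‖ + ‖A - P x * 1‖ + ‖A' - P x * -1‖ := by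
      rw [h3]
      exact (norm_add_le _ _).trans (by gcongr; exact norm_sub_le _ _)
    linarith

/-- Partial products `∏_{j < k} mobius (R j) (z ^ n j)`. -/
def partialProd (R : ℕ → ℝ) (n : ℕ → ℕ) (k : ℕ) (z : ℂ) : ℂ :=
  ∏ j ∈ Finset.range k, mobius (R j) (z ^ n j)

/-- Sequences of parameters, each built by `IsNextFactor` from the preceding ones. -/
structure IsFactorSequence (φ : ℝ → Torus → ℝ) (lam : ℝ → ℝ) (R : ℕ → ℝ) (n : ℕ → ℕ)
    (τ d : ℕ → ℝ) : Prop where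
  tau_zero : τ 0 = 1 / 2
  d_zero : d 0 = 1
  next : ∀ k, IsNextFactor φ lam (fun x => partialProd R n k (circ x)) (τ k) (d k) (R k) (n k)
    (τ (k + 1)) (d (k + 1))

variable {φ : ℝ → Torus → ℝ} {lam : ℝ → ℝ} {R : ℕ → ℝ} {n : ℕ → ℕ} {τ d : ℕ → ℝ}

lemma partialProd_succ (k : ℕ) (z : ℂ) :
    partialProd R n (k + 1) z = partialProd R n k z * mobius (R k) (z ^ n k) :=
  Finset.prod_range_succ _ _

lemma IsNextFactor.R_nonneg {P : Torus → ℂ} {τ d R : ℝ} {n : ℕ} {τ' d' : ℝ}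
    (h : IsNextFactor φ lam P τ d R n τ' d') : 0 ≤ R := by
  rw [h.R_eq]
  nlinarith [h.d_pos, h.d_le_const]

lemma IsNextFactor.R_lt_one {P : Torus → ℂ} {τ d R : ℝ} {n : ℕ} {τ' d' : ℝ}
    (h : IsNextFactor φ lam P τ d R n τ' d') : R < 1 := by
  rw [h.R_eq]
  nlinarith [h.d_pos]

lemma IsConcentratedAlong.exists_isFactorSequence (hφ : IsConcentratedAlong φ lam) :
    ∃ R n τ d, IsFactorSequence φ lam R n τ d := by
  let S := {s : (Torus → ℂ) × ℝ × ℝ //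
    Continuous s.1 ∧ (∀ x, ‖s.1 x‖ = 1) ∧ 0 < s.2.1 ∧ s.2.1 < 1 ∧ 0 < s.2.2}
  have hex : ∀ s : S, ∃ R n τ' d', IsNextFactor φ lam s.1.1 s.1.2.1 s.1.2.2 R n τ' d' := fun s =>
    hφ.exists_isNextFactor s.2.1 s.2.2.1 s.2.2.2.1 s.2.2.2.2.1 s.2.2.2.2.2
  choose R n τ' d' h using hex
  let next : S → S := fun s => ⟨(fun x => s.1.1 x * boundaryFactor (R s) (n s) x, τ' s, d' s),
    s.2.1.mul (continuous_boundaryFactor (h s).R_nonneg (h s).R_lt_one _),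
    fun x => by
      rw [norm_mul, s.2.2.1, norm_boundaryFactor (h s).R_nonneg (h s).R_lt_one, one_mul],
    s.2.2.2.1.trans (h s).lt_tau, (h s).tau_lt_one, (h s).d_pos⟩
  let s₀ : S := ⟨(fun _ => 1, 1 / 2, 1), continuous_const, fun _ => norm_one, by norm_num,
    by norm_num, by norm_num⟩
  let s : ℕ → S := fun k => next^[k] s₀
  have hs : ∀ k, s (k + 1) = next (s k) := fun k => Function.iterate_succ_apply' _ _ _
  have hP : ∀ k, (s k).1.1 = fun x => partialProd (fun k => R (s k)) (fun k => n (s k)) k (circ x) := by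
    intro k
    induction k with
    | zero => rfl
    | succ k ih =>
      rw [hs]
      funext x
      rw [partialProd_succ, ← congrFun ih x]
      rfl
  refine ⟨fun k => R (s k), fun k => n (s k), fun k => (s k).1.2.1, fun k => (s k).1.2.2, rfl, rfl,
    fun k => ?_⟩
  rw [← hP, hs]
  exact h (s k)

lemma norm_prod_range_sub_le {f : ℕ → ℂ} (hf : ∀ j, ‖f j‖ ≤ 1) {e : ℕ → ℝ} {k : ℕ}
    (he : ∀ i, ‖f (k + i) - 1‖ ≤ e i) (m : ℕ) :
    ‖∏ j ∈ Finset.range (k + m), f j - ∏ j ∈ Finset.range k, f j‖ ≤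
      ∑ i ∈ Finset.range m, e i := by
  induction m with
  | zero => simp
  | succ m ih =>
    rw [← add_assoc, Finset.prod_range_succ, Finset.sum_range_succ]
    set Q := ∏ j ∈ Finset.range (k + m), f j with hQ
    have hQ1 : ‖Q‖ ≤ 1 := by
      rw [hQ, norm_prod]
      exact Finset.prod_le_one (fun _ _ => norm_nonneg _) fun j _ => hf j
    calc ‖Q * f (k + m) - ∏ j ∈ Finset.range k, f j‖
        = ‖(Q - ∏ j ∈ Finset.range k, f j) + Q * (f (k + m) - 1)‖ := by ring_nf
      _ ≤ _ + ‖Q‖ * ‖f (k + m) - 1‖ := (norm_add_le _ _).trans_eq (by rw [norm_mul])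
      _ ≤ _ := add_le_add ih
          ((mul_le_of_le_one_left (norm_nonneg _) hQ1).trans (he m))

namespace IsFactorSequence

lemma d_pos (h : IsFactorSequence φ lam R n τ d) (k : ℕ) : 0 < d k := by
  cases k with
  | zero => rw [h.d_zero]; exact one_pos
  | succ k => exact (h.next k).d_pos

lemma d_add_le (h : IsFactorSequence φ lam R n τ d) (k i : ℕ) : d (k + i) ≤ d k * (1 / 2) ^ i := by
  induction i with
  | zero => simp
  | succ i ih =>
    have := (h.next (k + i)).d_le
    rw [← add_assoc, pow_succ]
    linarith

lemma d_le_pow (h : IsFactorSequence φ lam R n τ d) (k : ℕ) : d k ≤ (1 / 2) ^ k := by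
  have := h.d_add_le 0 k
  rwa [h.d_zero, one_mul, zero_add] at this

lemma tendsto_d (h : IsFactorSequence φ lam R n τ d) : Tendsto d atTop (𝓝 0) :=
  squeeze_zero (fun k => (h.d_pos k).le) h.d_le_pow
    (tendsto_pow_atTop_nhds_zero_of_lt_one (by norm_num) (by norm_num))

lemma sum_d_le (h : IsFactorSequence φ lam R n τ d) (k m : ℕ) :
    ∑ i ∈ Finset.range m, d (k + i) ≤ 2 * d k := by
  calc ∑ i ∈ Finset.range m, d (k + i) ≤ ∑ i ∈ Finset.range m, d k * (1 / 2) ^ i :=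
        Finset.sum_le_sum fun i _ => h.d_add_le k i
    _ = d k * ∑ i ∈ Finset.range m, (1 / 2 : ℝ) ^ i := (Finset.mul_sum _ _ _).symm
    _ ≤ d k * 2 := by
        have := h.d_pos k
        gcongr
        exact sum_geometric_two_le m
    _ = _ := mul_comm _ _

lemma one_sub_tau_le (h : IsFactorSequence φ lam R n τ d) (k : ℕ) : 1 - τ k ≤ (1 / 2) ^ k := by
  induction k with
  | zero => rw [h.tau_zero]; norm_num
  | succ k ih =>
    have := (h.next k).one_sub_tau_le
    rw [pow_succ]
    linarith

lemma tau_pos (h : IsFactorSequence φ lam R n τ d) (k : ℕ) : 0 < τ k := by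
  induction k with
  | zero => rw [h.tau_zero]; norm_num
  | succ k ih => exact ih.trans (h.next k).lt_tau

lemma tendsto_tau (h : IsFactorSequence φ lam R n τ d) : Tendsto τ atTop (𝓝 1) := by
  have h1 : Tendsto (fun k => 1 - τ k) atTop (𝓝 0) :=
    squeeze_zero (fun k => by linarith [(h.next k).lt_tau, (h.next k).tau_lt_one])
      h.one_sub_tau_le (tendsto_pow_atTop_nhds_zero_of_lt_one (by norm_num) (by norm_num))
  simpa using h1.const_sub 1

lemma norm_mobius_pow_le_one (h : IsFactorSequence φ lam R n τ d) {z : ℂ} (hz : ‖z‖ ≤ 1) (k : ℕ) :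
    ‖mobius (R k) (z ^ n k)‖ ≤ 1 :=
  norm_mobius_le_one (h.next k).R_nonneg (h.next k).R_lt_one
    (by rw [norm_pow]; exact pow_le_one₀ (norm_nonneg _) hz)

lemma continuous_partialProd_circ (h : IsFactorSequence φ lam R n τ d) (k : ℕ) :
    Continuous fun x : Torus => partialProd R n k (circ x) :=
  continuous_finsetProd _ fun j _ =>
    continuous_boundaryFactor (h.next j).R_nonneg (h.next j).R_lt_one (n j)

lemma norm_partialProd_circ (h : IsFactorSequence φ lam R n τ d) (k : ℕ) (x : Torus) :
    ‖partialProd R n k (circ x)‖ = 1 := by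
  rw [partialProd, norm_prod]
  exact Finset.prod_eq_one fun j _ =>
    norm_boundaryFactor (h.next j).R_nonneg (h.next j).R_lt_one (n j) x

end IsFactorSequence

/-- The set off which all factors with index at least `k` are near `1`. -/
def exceptionalSet (n : ℕ → ℕ) (d : ℕ → ℝ) (k : ℕ) : Set Torus :=
  ⋃ i, {x : Torus | ‖circ x ^ n (k + i) - 1‖ < d (k + i + 1)}

lemma measurableSet_exceptionalSet (n : ℕ → ℕ) (d : ℕ → ℝ) (k : ℕ) :
    MeasurableSet (exceptionalSet n d k) :=
  .iUnion fun i => (isOpen_lt ((continuous_circ.pow (n (k + i))).sub continuous_const).norm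
    continuous_const).measurableSet

lemma exceptionalSet_anti (n : ℕ → ℕ) (d : ℕ → ℝ) : Antitone (exceptionalSet n d) := by
  intro k l hkl x hx
  obtain ⟨i, hi⟩ := Set.mem_iUnion.1 hx
  obtain ⟨j, rfl⟩ := Nat.exists_eq_add_of_le hkl
  refine Set.mem_iUnion.2 ⟨j + i, ?_⟩
  rwa [← add_assoc]

namespace IsFactorSequence

lemma volume_exceptionalSet_le (h : IsFactorSequence φ lam R n τ d) (k : ℕ) :
    volume (exceptionalSet n d k) ≤ ENNReal.ofReal (2 * π * d (k + 1)) := by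
  refine (measure_iUnion_le _).trans ?_
  refine ENNReal.tsum_le_of_sum_range_le fun m => ?_
  calc ∑ i ∈ Finset.range m, volume {x : Torus | ‖circ x ^ n (k + i) - 1‖ < d (k + i + 1)}
      ≤ ∑ i ∈ Finset.range m, ENNReal.ofReal (π * d (k + 1 + i)) := by
        refine Finset.sum_le_sum fun i _ => ?_
        rw [add_right_comm k 1 i]
        exact volume_norm_circ_pow_sub_one_lt_le (h.next _).two_le _
    _ = ENNReal.ofReal (∑ i ∈ Finset.range m, π * d (k + 1 + i)) :=
        (ENNReal.ofReal_sum_of_nonneg fun i _ => mul_nonneg pi_pos.le (h.d_pos _).le).symm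
    _ ≤ _ := by
        refine ENNReal.ofReal_le_ofReal ?_
        rw [← Finset.mul_sum]
        nlinarith [h.sum_d_le (k + 1) m, pi_pos]

lemma volume_exceptionalSet_lt (h : IsFactorSequence φ lam R n τ d) (k : ℕ) :
    volume (exceptionalSet n d k) < ENNReal.ofReal (8 * d (k + 1)) := by
  refine (h.volume_exceptionalSet_le k).trans_lt ?_
  have := h.d_pos (k + 1)
  rw [ENNReal.ofReal_lt_ofReal_iff (by linarith)]
  nlinarith [pi_lt_d2]

lemma ae_exists_notMem_exceptionalSet (h : IsFactorSequence φ lam R n τ d) :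
    ∀ᵐ x : Torus, ∃ k, x ∉ exceptionalSet n d k := by
  rw [ae_iff]
  push Not
  have h1 : Tendsto (fun k => ENNReal.ofReal (2 * π * d (k + 1))) atTop (𝓝 0) := by
    have := (ENNReal.tendsto_ofReal (((tendsto_add_atTop_iff_nat 1).2 h.tendsto_d).const_mul (2 * π)))
    simpa using this
  refine le_antisymm (ge_of_tendsto' h1 fun k => ?_) bot_le
  have hsub : {x : Torus | ∀ k, x ∈ exceptionalSet n d k} ⊆ exceptionalSet n d k :=
    fun x hx => hx k
  exact (measure_mono hsub).trans (h.volume_exceptionalSet_le k)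

lemma norm_mobius_radial_sub_one_le (h : IsFactorSequence φ lam R n τ d) {k : ℕ} {x : Torus}
    (hx : d (k + 1) ≤ ‖circ x ^ n k - 1‖) {s : ℝ} (hs0 : 0 ≤ s) (hs1 : s ≤ 1) :
    ‖mobius (R k) ((s * circ x) ^ n k) - 1‖ ≤ d (k + 1) := by
  have h1 := norm_mobius_radial_sub_one_mul_le (h.next k).R_nonneg (h.next k).R_lt_one
    (norm_circ_pow x (n k)) (pow_nonneg hs0 (n k)) (pow_le_one₀ hs0 hs1)
  rw [Complex.ofReal_pow, ← mul_pow, norm_sub_rev 1] at h1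
  have h2 := h.d_pos (k + 1)
  have h3 := (h.next k).R_eq
  have h4 : ‖mobius (R k) ((s * circ x) ^ n k) - 1‖ * d (k + 1) ≤ d (k + 1) * d (k + 1) :=
    (mul_le_mul_of_nonneg_left hx (norm_nonneg _)).trans (h1.trans_eq (by rw [h3]; ring))
  exact le_of_mul_le_mul_right h4 h2

lemma norm_partialProd_sub_le (h : IsFactorSequence φ lam R n τ d) {k : ℕ} {x : Torus}
    (hx : x ∉ exceptionalSet n d k) {s : ℝ} (hs0 : 0 ≤ s) (hs1 : s ≤ 1) {m : ℕ} (hm : k ≤ m) :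
    ‖partialProd R n m (s * circ x) - partialProd R n k (s * circ x)‖ ≤ 2 * d (k + 1) := by
  obtain ⟨m, rfl⟩ := Nat.exists_eq_add_of_le hm
  have hz : ‖(s : ℂ) * circ x‖ ≤ 1 := by
    rwa [norm_mul, norm_circ, mul_one, Complex.norm_real, Real.norm_of_nonneg hs0]
  refine (norm_prod_range_sub_le (e := fun i => d (k + 1 + i)) (h.norm_mobius_pow_le_one hz)
    (fun i => ?_) m).trans (h.sum_d_le (k + 1) m)
  rw [add_right_comm k 1 i]
  refine h.norm_mobius_radial_sub_one_le ?_ hs0 hs1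
  have := fun hi => hx (Set.mem_iUnion.2 ⟨i, hi⟩)
  exact not_lt.1 this

lemma norm_partialProd_circ_sub_le (h : IsFactorSequence φ lam R n τ d) {k : ℕ} {x : Torus}
    (hx : x ∉ exceptionalSet n d k) {m : ℕ} (hm : k ≤ m) :
    ‖partialProd R n m (circ x) - partialProd R n k (circ x)‖ ≤ 2 * d (k + 1) := by
  simpa using h.norm_partialProd_sub_le hx zero_le_one le_rfl hm

end IsFactorSequence

/-- The boundary function of the infinite product. -/
def boundaryProd (R : ℕ → ℝ) (n : ℕ → ℕ) (x : Torus) : ℂ :=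
  limUnder atTop fun k => partialProd R n k (circ x)

/-- The zeros of the infinite product. -/
def zeros (R : ℕ → ℝ) (n : ℕ → ℕ) (i : Σ k, Polynomial.nthRootsFinset (n k) (1 : ℂ)) : ℂ :=
  ((R i.1 ^ (n i.1 : ℝ)⁻¹ : ℝ) : ℂ) * (i.2 : ℂ)⁻¹

/-- The infinite Blaschke product. -/
def blaschkeProd (R : ℕ → ℝ) (n : ℕ → ℕ) (z : ℂ) : ℂ :=
  ∏' i, blaschkeFactor (zeros R n i) z

namespace IsFactorSequence

lemma tendsto_boundaryProd (h : IsFactorSequence φ lam R n τ d) {k : ℕ} {x : Torus}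
    (hx : x ∉ exceptionalSet n d k) :
    Tendsto (fun m => partialProd R n m (circ x)) atTop (𝓝 (boundaryProd R n x)) := by
  refine CauchySeq.tendsto_limUnder (Metric.cauchySeq_iff'.2 fun ε hε => ?_)
  have h1 : ∀ᶠ m in atTop, 2 * d (m + 1) < ε := by
    have := ((tendsto_add_atTop_iff_nat 1).2 h.tendsto_d).const_mul 2
    rw [mul_zero] at this
    exact this.eventually_lt_const hε
  obtain ⟨N, hN, hkN⟩ := (h1.and (eventually_ge_atTop k)).exists
  refine ⟨N, fun m hm => ?_⟩
  rw [dist_eq_norm]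
  exact (h.norm_partialProd_circ_sub_le (fun hx' => hx (exceptionalSet_anti n d hkN hx')) hm).trans_lt
    hN

lemma norm_boundaryProd_sub_le (h : IsFactorSequence φ lam R n τ d) {k : ℕ} {x : Torus}
    (hx : x ∉ exceptionalSet n d k) :
    ‖boundaryProd R n x - partialProd R n k (circ x)‖ ≤ 2 * d (k + 1) :=
  le_of_tendsto ((h.tendsto_boundaryProd hx).sub_const _).norm
    ((eventually_ge_atTop k).mono fun _ hm => h.norm_partialProd_circ_sub_le hx hm)

lemma ae_tendsto_boundaryProd (h : IsFactorSequence φ lam R n τ d) :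
    ∀ᵐ x : Torus, Tendsto (fun m => partialProd R n m (circ x)) atTop (𝓝 (boundaryProd R n x)) :=
  h.ae_exists_notMem_exceptionalSet.mono fun _ ⟨_, hx⟩ => h.tendsto_boundaryProd hx

lemma aestronglyMeasurable_boundaryProd (h : IsFactorSequence φ lam R n τ d) :
    AEStronglyMeasurable (boundaryProd R n) volume :=
  aestronglyMeasurable_of_tendsto_ae atTop
    (fun k => (h.continuous_partialProd_circ k).aestronglyMeasurable) h.ae_tendsto_boundaryProd

lemma ae_norm_boundaryProd_le_one (h : IsFactorSequence φ lam R n τ d) :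
    ∀ᵐ x : Torus, ‖boundaryProd R n x‖ ≤ 1 :=
  h.ae_tendsto_boundaryProd.mono fun x hx =>
    le_of_tendsto' hx.norm fun k => (h.norm_partialProd_circ k x).le

lemma half_le_R (h : IsFactorSequence φ lam R n τ d) (k : ℕ) : 1 / 2 ≤ R k := by
  rw [(h.next k).R_eq]
  nlinarith [h.d_pos (k + 1), (h.next k).d_le_const]

lemma n_pos (h : IsFactorSequence φ lam R n τ d) (k : ℕ) : 0 < n k :=
  two_pos.trans_le (h.next k).two_le

lemma norm_zeros (h : IsFactorSequence φ lam R n τ d)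
    (i : Σ k, Polynomial.nthRootsFinset (n k) (1 : ℂ)) :
    ‖zeros R n i‖ = R i.1 ^ (n i.1 : ℝ)⁻¹ := by
  rw [zeros, norm_mul, norm_inv, norm_eq_one_of_mem_nthRootsFinset (h.n_pos _) i.2.2, inv_one,
    mul_one, Complex.norm_real, Real.norm_of_nonneg (Real.rpow_nonneg (h.next _).R_nonneg _)]

lemma norm_zeros_lt_one (h : IsFactorSequence φ lam R n τ d)
    (i : Σ k, Polynomial.nthRootsFinset (n k) (1 : ℂ)) : ‖zeros R n i‖ < 1 := by
  rw [h.norm_zeros]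
  exact Real.rpow_lt_one (h.next _).R_nonneg (h.next _).R_lt_one
    (inv_pos.2 (Nat.cast_pos.2 (h.n_pos _)))

lemma summable_one_sub_norm_zeros (h : IsFactorSequence φ lam R n τ d) :
    Summable fun i => 1 - ‖zeros R n i‖ := by
  rw [summable_sigma_of_nonneg fun i => sub_nonneg.2 (h.norm_zeros_lt_one i).le]
  refine ⟨fun k => Summable.of_finite, ?_⟩
  refine Summable.of_nonneg_of_le
    (fun k => tsum_nonneg fun j => sub_nonneg.2 (h.norm_zeros_lt_one ⟨k, j⟩).le) (fun k => ?_)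
    (summable_geometric_two)
  have hR := h.half_le_R k
  have hcard : (Polynomial.nthRootsFinset (n k) (1 : ℂ)).card = n k :=
    (Complex.isPrimitiveRoot_exp (n k) (h.n_pos k).ne').card_nthRootsFinset
  simp only [h.norm_zeros, tsum_fintype, Finset.sum_const, Finset.card_univ, Fintype.card_coe,
    hcard, nsmul_eq_mul]
  refine (mul_one_sub_rpow_inv_le (by linarith) (h.n_pos k)).trans ?_
  have h1 : (R k)⁻¹ - 1 ≤ 2 * (1 - R k) := by
    rw [sub_le_iff_le_add, inv_le_iff_one_le_mul₀ (by linarith)]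
    nlinarith [(h.next k).R_lt_one]
  have h2 := (h.next k).R_eq
  have h3 := h.d_le_pow (k + 1)
  rw [pow_succ] at h3
  nlinarith [h.d_pos (k + 1), (h.next k).d_le_const]

lemma hasProd_blaschkeProd (h : IsFactorSequence φ lam R n τ d) {z : ℂ} (hz : ‖z‖ < 1) :
    HasProd (fun i => blaschkeFactor (zeros R n i) z) (blaschkeProd R n z) :=
  (multipliable_blaschkeFactor h.norm_zeros_lt_one h.summable_one_sub_norm_zeros hz).hasProd

lemma isBlaschkeProduct (h : IsFactorSequence φ lam R n τ d) :
    IsBlaschkeProduct (blaschkeProd R n) :=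
  ⟨_, zeros R n, h.norm_zeros_lt_one, h.summable_one_sub_norm_zeros, fun _ hz =>
    h.hasProd_blaschkeProd hz⟩

lemma tendsto_partialProd (h : IsFactorSequence φ lam R n τ d) {z : ℂ} (hz : ‖z‖ < 1) :
    Tendsto (fun k => partialProd R n k z) atTop (𝓝 (blaschkeProd R n z)) := by
  refine ((h.hasProd_blaschkeProd hz).sigma (g := fun k => mobius (R k) (z ^ n k))
    fun k => ?_).tendsto_prod_nat
  have hR : 0 < R k := by linarith [h.half_le_R k]
  have h1 := prod_blaschkeFactor_nthRoots (h.n_pos k) (Real.rpow_pos_of_pos hR (n k : ℝ)⁻¹) z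
  rw [Real.rpow_inv_natCast_pow hR.le (h.n_pos k).ne', ← Finset.prod_coe_sort] at h1
  rw [← h1]
  exact hasProd_fintype _

lemma norm_blaschkeProd_sub_le (h : IsFactorSequence φ lam R n τ d) {k : ℕ} {x : Torus}
    (hx : x ∉ exceptionalSet n d k) {s : ℝ} (hs0 : 0 ≤ s) (hs1 : s < 1) :
    ‖blaschkeProd R n (s * circ x) - partialProd R n k (s * circ x)‖ ≤ 2 * d (k + 1) := by
  have hz : ‖(s : ℂ) * circ x‖ < 1 := by
    rwa [norm_mul, norm_circ, mul_one, Complex.norm_real, Real.norm_of_nonneg hs0]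
  exact le_of_tendsto ((h.tendsto_partialProd hz).sub_const _).norm
    ((eventually_ge_atTop k).mono fun _ hm => h.norm_partialProd_sub_le hx hs0 hs1.le hm)

lemma tendsto_partialProd_radial (h : IsFactorSequence φ lam R n τ d) (k : ℕ) (x : Torus) :
    Tendsto (fun s : ℝ => partialProd R n k (s * circ x)) (𝓝[<] 1)
      (𝓝 (partialProd R n k (circ x))) := by
  have hc : ContinuousAt (fun s : ℝ => partialProd R n k (s * circ x)) 1 := by
    refine tendsto_finsetProd _ fun j _ => ?_
    have h1 : ContinuousAt (fun s : ℝ => ((s : ℂ) * circ x) ^ n j) 1 := by fun_prop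
    refine (continuousAt_const.sub h1).div (continuousAt_const.sub (continuousAt_const.mul h1)) ?_
    refine one_sub_mul_ne_zero (h.next j).R_nonneg (h.next j).R_lt_one ?_
    rw [Complex.ofReal_one, one_mul, norm_circ_pow]
  have := hc.tendsto.mono_left (nhdsWithin_le_nhds (s := Set.Iio 1))
  simpa using this

lemma isBoundaryFunction (h : IsFactorSequence φ lam R n τ d) :
    IsBoundaryFunction (blaschkeProd R n) (boundaryProd R n) := by
  filter_upwards [h.ae_exists_notMem_exceptionalSet] with x ⟨k, hk⟩
  change Tendsto (fun s : ℝ => blaschkeProd R n (s * circ x)) _ _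
  rw [Metric.tendsto_nhds]
  intro ε hε
  have h1 : ∀ᶠ m in atTop, 2 * d (m + 1) < ε / 3 := by
    have := ((tendsto_add_atTop_iff_nat 1).2 h.tendsto_d).const_mul 2
    rw [mul_zero] at this
    exact this.eventually_lt_const (by linarith)
  obtain ⟨m, hm, hkm⟩ := (h1.and (eventually_ge_atTop k)).exists
  have hxm : x ∉ exceptionalSet n d m := fun hx => hk (exceptionalSet_anti n d hkm hx)
  filter_upwards [Metric.tendsto_nhds.1 (h.tendsto_partialProd_radial m x) (ε / 3) (by linarith),
    Ioo_mem_nhdsLT (zero_lt_one' ℝ)] with s hs hs01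
  have h2 := h.norm_blaschkeProd_sub_le hxm hs01.1.le hs01.2
  have h3 := h.norm_boundaryProd_sub_le hxm
  rw [← dist_eq_norm] at h2 h3
  rw [dist_comm] at h3
  have := dist_triangle4 (blaschkeProd R n (s * circ x)) (partialProd R n m (s * circ x))
    (partialProd R n m (circ x)) (boundaryProd R n x)
  linarith

lemma norm_Phi_boundaryProd_sub_le (h : IsFactorSequence φ lam R n τ d)
    (hφ : IsConcentratedAlong φ lam) {k : ℕ} {r : ℝ} (hr0 : 0 < r) (hrτ : r < τ k) (y : Torus) :
    ‖Phi φ r y (boundaryProd R n) - Phi φ r y (fun x => partialProd R n k (circ x))‖ ≤ 1 / 5 := by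
  have hr1 : r < 1 := by linarith [(h.next k).lt_tau, (h.next k).tau_lt_one]
  have hE := measurableSet_exceptionalSet n d k
  have hmp : MeasurePreserving (fun u : Torus => y - u) volume volume :=
    volume.measurePreserving_sub_left y
  have hvol : volume ((fun u : Torus => y - u) ⁻¹' exceptionalSet n d k) <
      ENNReal.ofReal (8 * d (k + 1)) := by
    rw [hmp.measure_preimage hE.nullMeasurableSet]
    exact h.volume_exceptionalSet_lt k
  have hd := (h.next k).d_le_const
  have hd0 := h.d_pos (k + 1)
  have := norm_integral_mul_sub_le (hφ.nonneg r hr0 hr1) (hφ.integral_eq_one r hr0 hr1)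
    h.aestronglyMeasurable_boundaryProd h.ae_norm_boundaryProd_le_one
    (h.continuous_partialProd_circ k).aestronglyMeasurable
    (.of_forall fun x => (h.norm_partialProd_circ k x).le) hE y
    (.of_forall fun x hx => h.norm_boundaryProd_sub_le hx) (by linarith)
    ((h.next k).setIntegral_lt r hr0 hrτ _ (hmp.measurable hE) hvol).le
  exact this.trans (by linarith)

lemma not_tendsto_Phi_boundaryProd (h : IsFactorSequence φ lam R n τ d)
    (hφ : IsConcentratedAlong φ lam) (x : Torus) :
    ¬ ∃ L : ℂ, Tendsto (fun r : ℝ => Phi φ r (x + (lam r : Torus)) (boundaryProd R n))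
      (𝓝[<] 1) (𝓝 L) := by
  rintro ⟨L, hL⟩
  obtain ⟨σ, hσ, hball⟩ := (mem_nhdsLT_iff_exists_Ioo_subset' (zero_lt_one' ℝ)).1
    (Metric.tendsto_nhds.1 hL (1 / 4) (by norm_num))
  obtain ⟨k, hk⟩ := (h.tendsto_tau.eventually_const_lt hσ).exists
  have hτ1 := (h.next k).tau_lt_one
  obtain ⟨r₁, hr₁, r₂, hr₂, hosc⟩ := (h.next k).oscillation x
  have close : ∀ r ∈ Set.Ioo (τ k) (τ (k + 1)),
      ‖Phi φ r (x + (lam r : Torus))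
        (fun t => partialProd R n k (circ t) * boundaryFactor (R k) (n k) t) - L‖ ≤ 9 / 20 := by
    intro r hr
    have h1 : dist (Phi φ r (x + (lam r : Torus)) (boundaryProd R n)) L < 1 / 4 :=
      hball ⟨hk.trans hr.1, hr.2.trans hτ1⟩
    have h2 := h.norm_Phi_boundaryProd_sub_le hφ ((h.tau_pos k).trans hr.1) hr.2
      (x + (lam r : Torus))
    simp only [partialProd_succ] at h2
    rw [← dist_eq_norm, dist_comm] at h2
    rw [← dist_eq_norm]
    exact (dist_triangle _ _ _).trans ((add_le_add h2 h1.le).trans (by norm_num))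
  have h1 := close r₁ hr₁
  have h2 := close r₂ hr₂
  have h3 := norm_sub_le_norm_sub_add_norm_sub
    (Phi φ r₁ (x + (lam r₁ : Torus))
      (fun t => partialProd R n k (circ t) * boundaryFactor (R k) (n k) t)) L
    (Phi φ r₂ (x + (lam r₂ : Torus))
      (fun t => partialProd R n k (circ t) * boundaryFactor (R k) (n k) t))
  rw [norm_sub_rev L] at h3
  linarith

end IsFactorSequence

end LittlewoodKernels

end

theorem theorem2
    (φ : ℝ → LittlewoodKernels.Torus → ℝ)
    (hφ_nonneg : ∀ r : ℝ, 0 < r → r < 1 → ∀ t : LittlewoodKernels.Torus, 0 ≤ φ r t)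
    (hφ_integral : ∀ r : ℝ, 0 < r → r < 1 → ∫ t : LittlewoodKernels.Torus, φ r t = 1)
    (hφ_abs : LittlewoodKernels.UniformlyAbsContinuous φ)
    (lam : ℝ → ℝ) (hlam_cont : ContinuousOn lam (Set.Icc 0 1)) (hlam_one : lam 1 = 0)
    (hbeta : LittlewoodKernels.beta φ lam = 1) :
    ∃ B : LittlewoodKernels.Torus → ℂ,
      MemLp B ⊤ (volume : Measure LittlewoodKernels.Torus) ∧
      (∃ F : ℂ → ℂ, LittlewoodKernels.IsBlaschkeProduct F ∧
        LittlewoodKernels.IsBoundaryFunction F B) ∧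
      ∀ x : LittlewoodKernels.Torus,
        ¬ ∃ L : ℂ, Tendsto
          (fun r : ℝ => LittlewoodKernels.Phi φ r (x + (lam r : LittlewoodKernels.Torus)) B)
          (𝓝[<] 1) (𝓝 L) := by
  have hφ : LittlewoodKernels.IsConcentratedAlong φ lam :=
    ⟨hφ_nonneg, hφ_integral, hφ_abs, hlam_cont, hlam_one, hbeta⟩
  obtain ⟨R, n, τ, d, h⟩ := hφ.exists_isFactorSequence
  exact ⟨LittlewoodKernels.boundaryProd R n,
    memLp_top_of_bound h.aestronglyMeasurable_boundaryProd 1 h.ae_norm_boundaryProd_le_one,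
    ⟨LittlewoodKernels.blaschkeProd R n, h.isBlaschkeProduct, h.isBoundaryFunction⟩,
    h.not_tendsto_Phi_boundaryProd hφ⟩
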